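/- There are absolute constants $C>0$ and $c\in\mathbb{N}$ such that for every finite connected simple undirected graph $G=(V,E)$ with $n=|V|$ vertices and hop-diameter $D$, $$\beta(G)+D\;\le\; C(\log n)^{c}\cdot MC(G)\qquad\text{and}\qquad MC(G)\;\le\; C(\log n)^{c}\cdot(\beta(G)+D),$$ that is, $\beta(G)+D=\tilde\Theta(MC(G))$, where $\tilde\Theta$ hides factors polylogarithmic in $n$. The quantities are defined as follows. A moving cut in $G$ is an assignment $\ell:E\to\mathbb{Z}_{\ge1}$ of positive integer edge lengths. Its capacity is $\sum_{e\in E}(\ell_e-1)$. It has distance $\beta$ with respect to pairs of vertices $S=\{(s_i,t_i)\}_{i=1}^k$ if the $\ell$-distance from $s_i$ to $t_j$ is at least $\beta$ for all $i,j\in\{1,\dots,k\}$. For such $S$, $MC(S)$ is the largest distance of a moving cut for $S$ of capacity strictly less than $k$. The pairs $S$ are connectable if there are pairwise vertex-disjoint paths $p_1,\dots,p_k$ in $G$ such that $p_i$ joins $s_i$ to $t_i$; and $MC(G)$ is the maximum of $MC(S)$ over all connectable $S$. A $\beta$-disjointness gadget in $G$ is a triple $(P,T,\ell)$ consisting of a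 nonempty set $P$ of pairwise vertex-disjoint paths in $G$, each with at least three edges; a tree $T\subseteq G$ whose vertex set meets the vertex set of each path of $P$ in exactly the two endpoints of that path; and a moving cut $\ell$ of capacity strictly less than $|P|$ and of distance $\beta$ with respect to the pairs $(s_i,t_i)$ of endpoints of the paths in $P$ (each path being given with an orientation from $s_i$ to $t_i$). Finally, $\beta(G)$ is the largest integer $\beta$ for which $G$ contains a $\beta$-disjointness gadget, and $\beta(G)=0$ if there is none. -/

import Mathlib

namespace UniversalOptimality

universe u

/-- A moving cut in `G`: positive integer lengths on the edges of `G`. (The value on an element of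
`Sym2 V` that is not an edge is irrelevant: only edges of `G` are ever used below.) -/
structure MovingCut {V : Type u} (G : SimpleGraph V) where
  /-- the length of an edge -/
  len : Sym2 V → ℕ
  one_le_len : ∀ e ∈ G.edgeSet, 1 ≤ len e

namespace MovingCut

variable {V : Type u} {G : SimpleGraph V}

open scoped Classical in
/-- The capacity `∑ₑ (ℓₑ - 1)`, the sum being over all edges of `G`. -/
noncomputable def capacity [Fintype V] (l : MovingCut G) : ℕ :=
  ∑ e ∈ G.edgeFinset, (l.len e - 1)

/-- The `ℓ`-length of a walk. -/
def walkLength (l : MovingCut G) {u v : V} (w : G.Walk u v) : ℕ :=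
  (w.edges.map l.len).sum

/-- The `ℓ`-distance between two vertices (`⊤` if no walk joins them). -/
noncomputable def dist (l : MovingCut G) (u v : V) : ℕ∞ :=
  ⨅ w : G.Walk u v, (l.walkLength w : ℕ∞)

/-- The `ℓ`-distance between the set of all sources `sᵢ` and the set of all sinks `tⱼ`
of a family of pairs `S i = (sᵢ, tᵢ)`. -/
noncomputable def pairsDist (l : MovingCut G) {k : ℕ} (S : Fin k → V × V) : ℕ∞ :=
  ⨅ i : Fin k, ⨅ j : Fin k, l.dist (S i).1 (S j).2

/-- `l` has capacity strictly less than the number `k` of pairs and distance (at least) `β`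
with respect to the pairs. -/
def Witnesses [Fintype V] (l : MovingCut G) {k : ℕ} (S : Fin k → V × V) (β : ℕ) : Prop :=
  l.capacity < k ∧ (β : ℕ∞) ≤ l.pairsDist S

end MovingCut

/-- The pairs `(sᵢ, tᵢ)` can be connected by pairwise vertex-disjoint paths in `G`. -/
def Connectable {V : Type u} (G : SimpleGraph V) {k : ℕ} (S : Fin k → V × V) : Prop :=
  ∃ p : ∀ i, G.Walk (S i).1 (S i).2, (∀ i, (p i).IsPath) ∧
    ∀ i j, i ≠ j → (p i).support.Disjoint (p j).support

/-- The largest distance of a moving cut for the `k` pairs `S` of capacity strictly less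
than `k`. -/
noncomputable def movingCutPairs {V : Type u} [Fintype V] (G : SimpleGraph V) {k : ℕ}
    (S : Fin k → V × V) : ℕ :=
  sSup {β : ℕ | ∃ l : MovingCut G, l.Witnesses S β}

/-- `MC(G)`: the maximum of `movingCutPairs G S` over all connectable families of pairs `S`. -/
noncomputable def movingCutNumber {V : Type u} [Fintype V] (G : SimpleGraph V) : ℕ :=
  sSup {m : ℕ | ∃ (k : ℕ) (S : Fin k → V × V), Connectable G S ∧ m = movingCutPairs G S}

/-- A `β`-disjointness gadget in `G`: a nonempty family of pairwise vertex-disjoint paths, each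
with at least three edges, a tree `T ⊆ G` meeting each path exactly in its two endpoints, and a
moving cut of capacity less than the number of paths and of distance `β` for the pairs of
endpoints of the paths. -/
structure DisjointnessGadget {V : Type u} [Fintype V] (G : SimpleGraph V) (β : ℕ) where
  /-- the number of paths -/
  k : ℕ
  k_pos : 0 < k
  /-- the endpoints of the paths -/
  ends : Fin k → V × V
  /-- the paths -/
  path : ∀ i, G.Walk (ends i).1 (ends i).2
  isPath : ∀ i, (path i).IsPath
  three_le_length : ∀ i, 3 ≤ (path i).length
  disjoint : ∀ i j, i ≠ j → (path i).support.Disjoint (path j).support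
  /-- the tree -/
  T : G.Subgraph
  isTree : T.coe.IsTree
  inter : ∀ i, T.verts ∩ {v | v ∈ (path i).support} = {(ends i).1, (ends i).2}
  /-- the moving cut -/
  cut : MovingCut G
  witnesses : cut.Witnesses ends β

/-- `β(G)`: the largest `β` for which `G` contains a `β`-disjointness gadget, and `0` if there
is none. -/
noncomputable def gadgetNumber {V : Type u} [Fintype V] (G : SimpleGraph V) : ℕ :=
  sSup {β : ℕ | Nonempty (DisjointnessGadget G β)}

/-! The suprema above are taken over bounded sets of natural numbers, hence are genuine. -/

section Bounded

variable {V : Type u} [Fintype V] {G : SimpleGraph V}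

open scoped Classical in
theorem MovingCut.walkLength_le (l : MovingCut G) {u v : V} (w : G.Walk u v) (hw : w.IsPath) :
    l.walkLength w ≤ l.capacity + G.edgeFinset.card := by
  have hnd : w.edges.Nodup := hw.isTrail.edges_nodup
  have h1 : l.walkLength w = ∑ e ∈ w.edges.toFinset, l.len e := by
    rw [List.sum_toFinset _ hnd]; rfl
  have hsub : w.edges.toFinset ⊆ G.edgeFinset := by
    intro e he
    rw [List.mem_toFinset] at he
    exact SimpleGraph.mem_edgeFinset.2 (w.edges_subset_edgeSet he)
  rw [h1, MovingCut.capacity, Finset.card_eq_sum_ones, ← Finset.sum_add_distrib]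
  refine (Finset.sum_le_sum_of_subset hsub).trans (Finset.sum_le_sum fun e _ => ?_)
  omega

theorem Connectable.le_card {k : ℕ} {S : Fin k → V × V} (h : Connectable G S) :
    k ≤ Fintype.card V := by
  obtain ⟨p, -, hd⟩ := h
  have hinj : Function.Injective fun i => (S i).1 := by
    intro i j hij
    by_contra hne
    refine hd i j hne (p i).start_mem_support ?_
    have hij' : (S i).1 = (S j).1 := hij
    rw [hij']
    exact (p j).start_mem_support
  simpa using Fintype.card_le_of_injective _ hinj

open scoped Classical in
theorem Connectable.bound {k : ℕ} {S : Fin k → V × V} (h : Connectable G S) {l : MovingCut G}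
    {β : ℕ} (hl : l.Witnesses S β) : β ≤ Fintype.card V + G.edgeFinset.card := by
  have hk := h.le_card
  obtain ⟨p, hp, -⟩ := h
  obtain ⟨hc, hb⟩ := hl
  have i : Fin k := ⟨0, by omega⟩
  have h1 : (β : ℕ∞) ≤ (l.walkLength (p i) : ℕ∞) :=
    hb.trans ((iInf_le _ i).trans ((iInf_le _ i).trans (iInf_le _ (p i))))
  have h2 : β ≤ l.walkLength (p i) := by exact_mod_cast h1
  have h3 := l.walkLength_le (p i) (hp i)
  omega

theorem bddAbove_movingCutPairs {k : ℕ} {S : Fin k → V × V} (h : Connectable G S) :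
    BddAbove {β : ℕ | ∃ l : MovingCut G, l.Witnesses S β} := by
  classical
  exact ⟨Fintype.card V + G.edgeFinset.card, fun _ ⟨_, hl⟩ => h.bound hl⟩

theorem bddAbove_movingCutNumber (G : SimpleGraph V) :
    BddAbove {m : ℕ | ∃ (k : ℕ) (S : Fin k → V × V), Connectable G S ∧
      m = movingCutPairs G S} := by
  classical
  refine ⟨Fintype.card V + G.edgeFinset.card, ?_⟩
  rintro m ⟨k, S, hS, rfl⟩
  exact csSup_le' fun _ ⟨_, hl⟩ => hS.bound hl

theorem bddAbove_gadgetNumber (G : SimpleGraph V) :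
    BddAbove {β : ℕ | Nonempty (DisjointnessGadget G β)} := by
  classical
  refine ⟨Fintype.card V + G.edgeFinset.card, ?_⟩
  rintro β ⟨g⟩
  exact Connectable.bound ⟨g.path, g.isPath, g.disjoint⟩ g.witnesses

end Bounded

end UniversalOptimality

/-!
Both inequalities hold without any logarithmic factor.

A disjointness gadget is in particular a connectable family of pairs with a moving cut, and a single
diametral pair with all lengths equal to `1` has distance `D`; hence `β(G) + D ≤ 2 MC(G)`.

For the converse, let `p₁, …, pₖ` be disjoint paths joining the pairs `S` and let `ℓ` be a moving cut
of capacity less than `k` and distance `β`. Put `ρ = 9 D + 8` and choose a maximal set `C` of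
terminals which are pairwise at `ℓ`-distance at least `2 ρ`. The `ℓ`-balls of radius `ρ` around the
centres in `C` are disjoint, and each of them misses some terminal, although every vertex is within
`D` hops of its centre. So the edges touching such a ball have total excess `ℓ - 1` at least
`ρ - D` (`ball_excess`). An edge touches at most two of the balls (`sum_excess_le`), so that
`|C| (ρ - D) < 2 k`. Consequently the centres can be joined by a connected set of at most
`|C| (D + 1) ≤ k / 4` vertices. Adding the balls of radius `2 ρ` around the centres, one obtains a
connected set `H` containing every terminal, and `T` is a spanning tree of `H`.

At most `k / 4` of the paths meet the connecting vertices, and at most `k / 4` of them touch edges of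
total excess at least `8`. On each of the others, a shortest subpath from a vertex of `H` close to
the sources to a vertex of `H` close to the sinks meets `H` in its two endpoints only, and it has
`ℓ`-length at least `β - 4 ρ`, hence at least three edges unless `β = O(D)`. Halving the excess of `ℓ`
makes its capacity smaller than the number of these paths, at the cost of a factor of `2` in the
distance (`exists_gadget`).
-/

namespace UniversalOptimality

open SimpleGraph Finset

universe u

variable {V : Type u} {G : SimpleGraph V}

namespace MovingCut

/-! ### The metric of a moving cut -/

theorem le_dist_iff (l : MovingCut G) {u v : V} {r : ℕ} :
    (r : ℕ∞) ≤ l.dist u v ↔ ∀ w : G.Walk u v, r ≤ l.walkLength w := by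
  simp only [dist, le_iInf_iff, Nat.cast_le]

theorem le_pairsDist_iff (l : MovingCut G) {k r : ℕ} {S : Fin k → V × V} :
    (r : ℕ∞) ≤ l.pairsDist S ↔
      ∀ (i j : Fin k) (w : G.Walk (S i).1 (S j).2), r ≤ l.walkLength w := by
  simp only [pairsDist, le_iInf_iff, le_dist_iff]

@[simp]
theorem walkLength_nil (l : MovingCut G) (u : V) : l.walkLength (Walk.nil : G.Walk u u) = 0 := by
  simp [walkLength]

@[simp]
theorem walkLength_append (l : MovingCut G) {u v w : V} (p : G.Walk u v) (q : G.Walk v w) :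
    l.walkLength (p.append q) = l.walkLength p + l.walkLength q := by
  simp [walkLength]

@[simp]
theorem walkLength_reverse (l : MovingCut G) {u v : V} (p : G.Walk u v) :
    l.walkLength p.reverse = l.walkLength p := by
  simp [walkLength]

theorem walkLength_takeUntil_le [DecidableEq V] (l : MovingCut G) {u v w : V} (p : G.Walk u v)
    (h : w ∈ p.support) : l.walkLength (p.takeUntil w h) ≤ l.walkLength p := by
  conv_rhs => rw [← p.take_spec h]
  rw [walkLength_append]
  exact Nat.le_add_right _ _

/-- The vertices at `ℓ`-distance less than `r` from `c`. -/
def ball (l : MovingCut G) (c : V) (r : ℕ) : Set V :=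
  {v | ∃ w : G.Walk c v, l.walkLength w < r}

theorem length_le_walkLength (l : MovingCut G) {u v : V} (w : G.Walk u v) :
    w.length ≤ l.walkLength w := by
  rw [walkLength, ← w.length_edges, ← List.length_map (as := w.edges) l.len]
  refine List.length_le_sum_of_one_le _ fun i hi => ?_
  obtain ⟨e, he, rfl⟩ := List.mem_map.1 hi
  exact l.one_le_len e (w.edges_subset_edgeSet he)

/-! ### Excess of the edges touching a set of vertices -/

section Excess

variable [Fintype V]

open scoped Classical in
/-- The total excess `∑ₑ (ℓₑ - 1)` of the edges with at least one endpoint in `U`. -/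
noncomputable def excess (l : MovingCut G) (U : Set V) : ℕ :=
  ∑ e ∈ G.edgeFinset with ∃ v ∈ e, v ∈ U, (l.len e - 1)

open scoped Classical in
/-- Disjoint vertex sets have total excess at most twice the capacity, since an edge has only two
endpoints. -/
theorem sum_excess_le (l : MovingCut G) {ι : Type*} (J : Finset ι) (U : ι → Set V)
    (hU : ∀ i ∈ J, ∀ j ∈ J, i ≠ j → Disjoint (U i) (U j)) :
    ∑ j ∈ J, l.excess (U j) ≤ 2 * l.capacity := by
  simp only [excess, sum_filter]
  rw [sum_comm, capacity, mul_sum]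
  refine sum_le_sum fun e _ => ?_
  rw [← sum_filter, sum_const, smul_eq_mul]
  refine Nat.mul_le_mul_right _ ?_
  have key : ∀ a : V, #{j ∈ J | a ∈ U j} ≤ 1 := by
    intro a
    rw [card_le_one]
    intro i hi j hj
    rw [mem_filter] at hi hj
    by_contra hne
    exact Set.disjoint_left.1 (hU i hi.1 j hj.1 hne) hi.2 hj.2
  induction e with
  | h a b =>
    calc #{j ∈ J | ∃ v ∈ s(a, b), v ∈ U j}
        ≤ #({j ∈ J | a ∈ U j} ∪ {j ∈ J | b ∈ U j}) := by
          refine card_le_card fun j hj => ?_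
          simp only [mem_filter, mem_union, Sym2.mem_iff, exists_eq_or_imp, exists_eq_left] at hj ⊢
          tauto
      _ ≤ _ := card_union_le _ _
      _ ≤ 2 := by linarith [key a, key b]

theorem walkLength_le_length_add_excess (l : MovingCut G) {u v : V} (w : G.Walk u v)
    (hw : w.IsPath) (U : Set V) (hU : ∀ e ∈ w.edges, ∃ v ∈ e, v ∈ U) :
    l.walkLength w ≤ w.length + l.excess U := by
  classical
  have hnd : w.edges.Nodup := hw.isTrail.edges_nodup
  have h1 : l.walkLength w = ∑ e ∈ w.edges.toFinset, l.len e := by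
    rw [List.sum_toFinset _ hnd]; rfl
  have h2 : w.length = ∑ e ∈ w.edges.toFinset, 1 := by
    rw [← card_eq_sum_ones, List.toFinset_card_of_nodup hnd, w.length_edges]
  have h3 : ∑ e ∈ w.edges.toFinset, (l.len e - 1) ≤ l.excess U := by
    refine sum_le_sum_of_subset fun e he => ?_
    rw [List.mem_toFinset] at he
    exact mem_filter.2 ⟨mem_edgeFinset.2 (w.edges_subset_edgeSet he), hU e he⟩
  rw [h1, h2]
  refine le_trans ?_ (Nat.add_le_add_left h3 _)
  rw [← sum_add_distrib]
  exact sum_le_sum fun e _ => by omega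

/-- A ball of radius `r` that is not the whole vertex set touches edges of total excess at least
`r - D`, because some vertex outside it can be reached in at most `D` hops. -/
theorem ball_excess (l : MovingCut G) (hG : G.Connected) (c t : V) (r : ℕ)
    (ht : t ∉ l.ball c r) : r ≤ G.diam + l.excess (l.ball c r) := by
  classical
  -- a hop-shortest path to the outside vertex with the fewest hops leaves the ball only at its end
  obtain ⟨v, hv, hmin⟩ := Set.exists_min_image {v | v ∉ l.ball c r} (G.dist c) (Set.toFinite _)
    ⟨t, ht⟩
  obtain ⟨w, hw, hlen⟩ := hG.exists_path_of_dist c v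
  have hin : ∀ z ∈ w.support, z ≠ v → z ∈ l.ball c r := by
    intro z hz hzv
    by_contra hzb
    have h1 := hmin z hzb
    have h2 : G.dist c z ≤ (w.takeUntil z hz).length := dist_le _
    have h3 := w.length_takeUntil_lt_length hz hzv
    omega
  have hU : ∀ e ∈ w.edges, ∃ x ∈ e, x ∈ l.ball c r := by
    intro e he
    induction e with
    | h a b =>
      have hab : a ≠ b := (w.adj_of_mem_edges he).ne
      by_cases ha : a = v
      · exact ⟨b, Sym2.mem_mk_right _ _,
          hin b (w.snd_mem_support_of_mem_edges he) fun h => hab (ha.trans h.symm)⟩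
      · exact ⟨a, Sym2.mem_mk_left _ _, hin a (w.fst_mem_support_of_mem_edges he) ha⟩
  have h1 := l.walkLength_le_length_add_excess w hw _ hU
  have h2 : r ≤ l.walkLength w := by
    by_contra h
    exact hv ⟨w, not_le.1 h⟩
  have : Nonempty V := ⟨c⟩
  have h3 : G.dist c v ≤ G.diam := dist_le_diam (connected_iff_ediam_ne_top.1 hG)
  omega

end Excess

/-! ### Halving a moving cut -/

/-- The moving cut whose edges have half the excess, rounded down. -/
def halve (l : MovingCut G) : MovingCut G where
  len e := 1 + (l.len e - 1) / 2
  one_le_len _ _ := Nat.le_add_right _ _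

theorem two_mul_capacity_halve_le [Fintype V] (l : MovingCut G) :
    2 * l.halve.capacity ≤ l.capacity := by
  rw [capacity, capacity, mul_sum]
  refine sum_le_sum fun e _ => ?_
  simp only [halve]
  omega

theorem walkLength_le_two_mul_halve (l : MovingCut G) {u v : V} (w : G.Walk u v) :
    l.walkLength w ≤ 2 * l.halve.walkLength w := by
  rw [walkLength, walkLength, ← List.sum_map_mul_left]
  refine List.sum_le_sum fun e _ => ?_
  simp only [halve]
  omega

end MovingCut

/-! ### Subpaths and trees -/

/-- A path from `A` to `B` has a subpath from `A` to `B` with no interior vertex in `A ∪ B`. -/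
theorem exists_subpath_between {u v : V} (p : G.Walk u v) (hp : p.IsPath) (A B : Set V)
    (hu : u ∈ A) (hv : v ∈ B) :
    ∃ x ∈ A, ∃ y ∈ B, ∃ q : G.Walk x y, q.IsPath ∧ q.support ⊆ p.support ∧
      ∀ z ∈ q.support, z ∈ A ∪ B → z = x ∨ z = y := by
  classical
  let P : ℕ → Prop := fun n => ∃ x ∈ A, ∃ y ∈ B, ∃ q : G.Walk x y, q.IsPath ∧
    q.support ⊆ p.support ∧ q.length = n
  have hP : ∃ n, P n := ⟨_, u, hu, v, hv, p, hp, List.Subset.refl _, rfl⟩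
  obtain ⟨x, hx, y, hy, q, hq, hsub, hlen⟩ := Nat.find_spec hP
  refine ⟨x, hx, y, hy, q, hq, hsub, fun z hz hzAB => ?_⟩
  by_contra! hne
  rcases hzAB with hzA | hzB
  · have hlt : (q.dropUntil z hz).length < Nat.find hP :=
      hlen ▸ q.length_dropUntil_lt_length hz hne.1
    exact Nat.find_min hP hlt ⟨z, hzA, y, hy, _, hq.dropUntil hz,
      List.Subset.trans (q.support_dropUntil_subset_support hz) hsub, rfl⟩
  · have hlt : (q.takeUntil z hz).length < Nat.find hP :=
      hlen ▸ q.length_takeUntil_lt_length hz hne.2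
    exact Nat.find_min hP hlt ⟨x, hx, z, hzB, _, hq.takeUntil hz,
      List.Subset.trans (q.support_takeUntil_subset_support hz) hsub, rfl⟩

theorem exists_tree_of_induce_connected [Fintype V] (H : Set V) (hH : (G.induce H).Connected) :
    ∃ T : G.Subgraph, T.verts = H ∧ T.coe.IsTree := by
  obtain ⟨T, hle, hT⟩ := hH.exists_isTree_le
  refine ⟨{ verts := H
            Adj := fun a b => ∃ (ha : a ∈ H) (hb : b ∈ H), T.Adj ⟨a, ha⟩ ⟨b, hb⟩
            adj_sub := fun ⟨_, _, h⟩ => hle h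
            edge_vert := fun ⟨ha, _, _⟩ => ha
            symm := ⟨fun _ _ ⟨ha, hb, h⟩ => ⟨hb, ha, h.symm⟩⟩ }, rfl, ?_⟩
  convert hT using 1
  ext a b
  exact ⟨fun ⟨_, _, h⟩ => h, fun h => ⟨a.2, b.2, h⟩⟩

/-- The union of the supports of a family of walks with a common start is connected. -/
theorem induce_connected_of_walks {r : V} (H : Set V) (hr : r ∈ H)
    (hH : ∀ v ∈ H, ∃ w : G.Walk r v, ∀ z ∈ w.support, z ∈ H) : (G.induce H).Connected := by
  refine induce_connected_of_patches r hr fun {v} hv => ?_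
  obtain ⟨w, hw⟩ := hH v hv
  exact ⟨{z | z ∈ w.support}, hw, w.start_mem_support, w.end_mem_support,
    w.connected_induce_support.preconnected _ _⟩

/-! ### The connected set through the terminals -/

namespace MovingCut

/-- A maximal `r`-separated subset of a finite set `X` is an `r`-net of `X`. -/
theorem exists_separated_net [Fintype V] (l : MovingCut G) (X : Set V) {r : ℕ} (hr : 0 < r) :
    ∃ C : Finset V, (∀ c ∈ C, c ∈ X) ∧ (∀ c ∈ C, ∀ d ∈ C, c ≠ d → d ∉ l.ball c r) ∧
      ∀ x ∈ X, ∃ c ∈ C, x ∈ l.ball c r := by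
  classical
  obtain ⟨C, hC⟩ := Set.Finite.exists_maximal
    (s := {C : Finset V | (∀ c ∈ C, c ∈ X) ∧ ∀ c ∈ C, ∀ d ∈ C, c ≠ d → d ∉ l.ball c r})
    (Set.toFinite _) ⟨∅, by simp⟩
  refine ⟨C, hC.1.1, hC.1.2, fun x hx => ?_⟩
  by_contra! hfar
  have hxC : x ∉ C := fun h => hfar x h ⟨Walk.nil, by simpa using hr⟩
  refine hxC (hC.2 (y := insert x C) ⟨?_, ?_⟩ (subset_insert _ _) (mem_insert_self _ _))
  · intro c hc
    rcases mem_insert.1 hc with rfl | hc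
    · exact hx
    · exact hC.1.1 c hc
  · intro c hc d hd hne
    rcases mem_insert.1 hc with rfl | hc' <;> rcases mem_insert.1 hd with rfl | hd'
    · exact absurd rfl hne
    · rintro ⟨w, hw⟩
      exact hfar d hd' ⟨w.reverse, by simpa using hw⟩
    · exact hfar c hc'
    · exact hC.1.2 c hc' d hd' hne

/-- If no ball of radius `ρ` around a vertex of `X` contains all vertices, then `X` lies in a
connected set `H` made of balls of radius `2 ρ` around vertices of `X` and of a set `H₀` of few
connecting vertices. -/
theorem exists_connected_cover [Fintype V] (l : MovingCut G) (hG : G.Connected) (X : Set V)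
    (hX : X.Nonempty) {ρ : ℕ} (hρ : 0 < ρ) (hball : ∀ c ∈ X, ∃ t, t ∉ l.ball c ρ) :
    ∃ (H : Set V) (H₀ : Finset V), X ⊆ H ∧ (G.induce H).Connected ∧
      (∀ v ∈ H, v ∈ H₀ ∨ ∃ c ∈ X, v ∈ l.ball c (2 * ρ)) ∧
      #H₀ * (ρ - G.diam) ≤ 2 * l.capacity * (G.diam + 1) := by
  classical
  obtain ⟨C, hCX, hsep, hnet⟩ := l.exists_separated_net X (r := 2 * ρ) (by omega)
  obtain ⟨x₀, hx₀⟩ := hX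
  obtain ⟨r, hr, -⟩ := hnet x₀ hx₀
  choose p hp using fun c => hG.exists_walk_length_eq_dist r c
  have : Nonempty V := ⟨r⟩
  have hpd : ∀ c, (p c).length ≤ G.diam := fun c =>
    (hp c).trans_le (dist_le_diam (connected_iff_ediam_ne_top.1 hG))
  set H₀ : Finset V := C.biUnion fun c => (p c).support.toFinset with hH₀
  have hmem₀ : ∀ c ∈ C, ∀ z ∈ (p c).support, z ∈ H₀ := fun c hc z hz =>
    mem_biUnion.2 ⟨c, hc, List.mem_toFinset.2 hz⟩
  set H : Set V := {v | v ∈ H₀ ∨ ∃ c ∈ C, v ∈ l.ball c (2 * ρ)} with hH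
  refine ⟨H, H₀, fun x hx => Or.inr (hnet x hx), ?_, ?_, ?_⟩
  · refine induce_connected_of_walks (r := r) H
      (Or.inl (hmem₀ r hr _ (p r).start_mem_support)) ?_
    rintro v (hv | ⟨c, hc, w, hw⟩)
    · obtain ⟨c, hc, hv⟩ := mem_biUnion.1 hv
      rw [List.mem_toFinset] at hv
      exact ⟨(p c).takeUntil v hv, fun z hz =>
        Or.inl (hmem₀ c hc z ((p c).support_takeUntil_subset_support hv hz))⟩
    · refine ⟨(p c).append w, fun z hz => ?_⟩
      rcases (Walk.mem_support_append_iff _ _).1 hz with hz | hz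
      · exact Or.inl (hmem₀ c hc z hz)
      · exact Or.inr ⟨c, hc, w.takeUntil z hz, (l.walkLength_takeUntil_le w hz).trans_lt hw⟩
  · rintro v (hv | ⟨c, hc, hv⟩)
    · exact Or.inl hv
    · exact Or.inr ⟨c, hCX c hc, hv⟩
  · have hdisj : ∀ c ∈ C, ∀ d ∈ C, c ≠ d → Disjoint (l.ball c ρ) (l.ball d ρ) := by
      intro c hc d hd hne
      rw [Set.disjoint_left]
      rintro v ⟨w₁, h₁⟩ ⟨w₂, h₂⟩
      refine hsep c hc d hd hne ⟨w₁.append w₂.reverse, ?_⟩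
      rw [walkLength_append, walkLength_reverse]
      omega
    have h1 : #C * (ρ - G.diam) ≤ 2 * l.capacity := by
      refine le_trans ?_ (l.sum_excess_le C (fun c => l.ball c ρ) hdisj)
      rw [← smul_eq_mul]
      refine card_nsmul_le_sum _ _ _ fun c hc => ?_
      obtain ⟨t, ht⟩ := hball c (hCX c hc)
      have := l.ball_excess hG c t ρ ht
      omega
    have h2 : #H₀ ≤ #C * (G.diam + 1) := by
      refine card_biUnion_le_card_mul _ _ _ fun c _ => ?_
      refine (List.toFinset_card_le _).trans ?_
      rw [Walk.length_support]
      exact Nat.add_le_add_right (hpd c) 1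
    calc #H₀ * (ρ - G.diam) ≤ #C * (G.diam + 1) * (ρ - G.diam) := Nat.mul_le_mul_right _ h2
      _ = #C * (ρ - G.diam) * (G.diam + 1) := by ring
      _ ≤ _ := Nat.mul_le_mul_right _ h1

end MovingCut

/-! ### From moving cuts to gadgets -/

open scoped Classical in
/-- At most `|X|` of a family of disjoint paths meet a set `X` of vertices. -/
theorem card_paths_meeting_le {k : ℕ} {S : Fin k → V × V} (p : ∀ i, G.Walk (S i).1 (S i).2)
    (hd : ∀ i j, i ≠ j → (p i).support.Disjoint (p j).support) (X : Finset V) :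
    #{i | ∃ z ∈ X, z ∈ (p i).support} ≤ #X := by
  have hz : ∀ i, ∃ z, (∃ z ∈ X, z ∈ (p i).support) → z ∈ X ∧ z ∈ (p i).support := by
    intro i
    by_cases h : ∃ z ∈ X, z ∈ (p i).support
    · exact ⟨h.choose, fun _ => h.choose_spec⟩
    · exact ⟨(S i).1, fun h' => absurd h' h⟩
  choose f hf using hz
  refine card_le_card_of_injOn f (fun i hi => (hf i (mem_filter.1 hi).2).1)
    fun i hi j hj hij => ?_
  by_contra hne
  exact hd i j hne (hf i (mem_filter.1 hi).2).2 (hij ▸ (hf j (mem_filter.1 hj).2).2)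

open scoped Classical in
/-- Among disjoint paths, the number of those touching edges of total excess at least `8` is at most a
quarter of the capacity. -/
theorem MovingCut.card_paths_excess_le [Fintype V] (l : MovingCut G) {k : ℕ} {S : Fin k → V × V}
    (p : ∀ i, G.Walk (S i).1 (S i).2)
    (hd : ∀ i j, i ≠ j → (p i).support.Disjoint (p j).support) :
    #{i | 8 ≤ l.excess {z | z ∈ (p i).support}} * 8 ≤ 2 * l.capacity := by
  refine le_trans ?_ (l.sum_excess_le {i | 8 ≤ l.excess {z | z ∈ (p i).support}}
    (fun i => {z | z ∈ (p i).support}) fun i _ j _ hne =>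
      Set.disjoint_left.2 fun z hi hj => hd i j hne hi hj)
  rw [← smul_eq_mul]
  exact card_nsmul_le_sum _ _ _ fun i hi => (mem_filter.1 hi).2

/-- A moving cut for connectable pairs whose distance is large compared to the hop-diameter yields a
gadget of about half that distance. -/
theorem exists_gadget [Fintype V] (hG : G.Connected) {k : ℕ} {S : Fin k → V × V}
    (hS : Connectable G S) {l : MovingCut G} {β : ℕ} (hl : l.Witnesses S β)
    (hβ : 4 * (9 * G.diam + 8) + 10 ≤ β) :
    Nonempty (DisjointnessGadget G ((β - 4 * (9 * G.diam + 8)) / 2)) := by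
  classical
  obtain ⟨p, hp, hd⟩ := hS
  obtain ⟨hcap, hdist⟩ := hl
  rw [MovingCut.le_pairsDist_iff] at hdist
  set ρ := 9 * G.diam + 8 with hρ
  have i₀ : Fin k := ⟨0, by omega⟩
  obtain ⟨H, H₀, hXH, hconn, hcover, hcard⟩ := l.exists_connected_cover hG
    {v | ∃ i, v = (S i).1 ∨ v = (S i).2} ⟨(S i₀).1, i₀, Or.inl rfl⟩ (ρ := ρ) (by omega) (by
      rintro c ⟨i, rfl | rfl⟩
      · refine ⟨(S i).2, fun ⟨w, hw⟩ => ?_⟩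
        have := hdist i i w
        omega
      · refine ⟨(S i).1, fun ⟨w, hw⟩ => ?_⟩
        have := hdist i i w.reverse
        rw [MovingCut.walkLength_reverse] at this
        omega)
  obtain ⟨T, hTv, hT⟩ := exists_tree_of_induce_connected H hconn
  set A : Set V := {x | ∃ i, x ∈ l.ball (S i).1 (2 * ρ)} with hA
  set B : Set V := {y | ∃ j, y ∈ l.ball (S j).2 (2 * ρ)} with hB
  have hAB : ∀ x ∈ A, ∀ y ∈ B, ∀ w : G.Walk x y, β - 4 * ρ ≤ l.walkLength w := by
    rintro x ⟨i, w₁, h₁⟩ y ⟨j, w₂, h₂⟩ w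
    have := hdist i j ((w₁.append w).append w₂.reverse)
    simp only [MovingCut.walkLength_append, MovingCut.walkLength_reverse] at this
    omega
  set R₁ : Finset (Fin k) := {i | ∃ z ∈ H₀, z ∈ (p i).support} with hR₁
  set R₂ : Finset (Fin k) := {i | 8 ≤ l.excess {z | z ∈ (p i).support}} with hR₂
  set R : Finset (Fin k) := (R₁ ∪ R₂)ᶜ with hR
  have hR₁card : 4 * #R₁ ≤ k := by
    have h1 : #R₁ ≤ #H₀ := card_paths_meeting_le p hd H₀
    have h2 : (#H₀ * 8) * (G.diam + 1) ≤ (2 * l.capacity) * (G.diam + 1) := by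
      refine le_trans (le_of_eq ?_) hcard
      rw [show ρ - G.diam = 8 * (G.diam + 1) by omega]
      ring
    have h3 := Nat.le_of_mul_le_mul_right h2 (Nat.succ_pos _)
    omega
  have hR₂card : 4 * #R₂ ≤ k := by
    have : #R₂ * 8 ≤ 2 * l.capacity := l.card_paths_excess_le p hd
    omega
  have hRcard : k ≤ 2 * #R := by
    have h1 := card_union_le R₁ R₂
    have h2 : #(R₁ ∪ R₂) + #R = k := by rw [hR, card_add_card_compl, Fintype.card_fin]
    omega
  have hsub : ∀ i : R, ∃ x ∈ A ∩ H, ∃ y ∈ B ∩ H, ∃ q : G.Walk x y, q.IsPath ∧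
      q.support ⊆ (p i).support ∧ 3 ≤ q.length ∧ H ∩ {v | v ∈ q.support} = {x, y} := by
    rintro ⟨i, hi⟩
    obtain ⟨hi₁, hi₂⟩ : i ∉ R₁ ∧ i ∉ R₂ := by simpa [hR] using hi
    obtain ⟨x, hx, y, hy, q, hq, hqs, hqi⟩ := exists_subpath_between (p i) (hp i) (A ∩ H) (B ∩ H)
      ⟨⟨i, Walk.nil, by simp; omega⟩, hXH ⟨i, Or.inl rfl⟩⟩
      ⟨⟨i, Walk.nil, by simp; omega⟩, hXH ⟨i, Or.inr rfl⟩⟩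
    refine ⟨x, hx, y, hy, q, hq, hqs, ?_, ?_⟩
    · have h1 := hAB x hx.1 y hy.1 q
      have h2 := l.walkLength_le_length_add_excess q hq {z | z ∈ (p i).support} (by
        intro e he
        induction e with
        | h a b =>
          exact ⟨a, Sym2.mem_mk_left _ _, hqs (q.fst_mem_support_of_mem_edges he)⟩)
      have h3 : l.excess {z | z ∈ (p i).support} < 8 := by simpa [hR₂] using hi₂
      omega
    · ext z
      constructor
      · rintro ⟨hzH, hzq⟩
        refine hqi z hzq ?_
        rcases hcover z hzH with hz | ⟨c, ⟨j, rfl | rfl⟩, hz⟩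
        · exact absurd (mem_filter.2 ⟨mem_univ _, z, hz, hqs hzq⟩) hi₁
        · exact Or.inl ⟨⟨j, hz⟩, hzH⟩
        · exact Or.inr ⟨⟨j, hz⟩, hzH⟩
      · rintro (rfl | rfl)
        · exact ⟨hx.2, q.start_mem_support⟩
        · exact ⟨hy.2, q.end_mem_support⟩
  choose x hx y hy q hq hqs hq3 hqH using hsub
  let e : Fin #R ≃ R := R.equivFin.symm
  refine ⟨{ k := #R
            k_pos := by have := i₀.pos; omega
            ends := fun i => (x (e i), y (e i))
            path := fun i => q (e i)
            isPath := fun i => hq (e i)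
            three_le_length := fun i => hq3 (e i)
            disjoint := fun i j hij => ?_
            T := T
            isTree := hT
            inter := fun i => by rw [hTv]; exact hqH (e i)
            cut := l.halve
            witnesses := ⟨?_, ?_⟩ }⟩
  · have hne : (e i : Fin k) ≠ e j := fun h => hij (e.injective (Subtype.ext h))
    exact fun z hi hj => hd _ _ hne (hqs _ hi) (hqs _ hj)
  · have := l.two_mul_capacity_halve_le
    omega
  · rw [MovingCut.le_pairsDist_iff]
    intro i j w
    have h1 := hAB _ (hx (e i)).1 _ (hy (e j)).1 w
    have h2 := l.walkLength_le_two_mul_halve w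
    omega

/-! ### Comparison of the two parameters -/

theorem gadgetNumber_le_movingCutNumber [Fintype V] (G : SimpleGraph V) :
    gadgetNumber G ≤ movingCutNumber G := by
  refine csSup_le' ?_
  rintro β ⟨g⟩
  have hS : Connectable G g.ends := ⟨g.path, g.isPath, g.disjoint⟩
  exact (le_csSup (bddAbove_movingCutPairs hS) ⟨g.cut, g.witnesses⟩).trans
    (le_csSup (bddAbove_movingCutNumber G) ⟨g.k, g.ends, hS, rfl⟩)

/-- A single pair of vertices at maximal hop-distance, with all lengths equal to `1`. -/
theorem diam_le_movingCutNumber [Fintype V] (hG : G.Connected) :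
    G.diam ≤ movingCutNumber G := by
  have := hG.nonempty
  obtain ⟨u, v, huv⟩ := G.exists_dist_eq_diam
  obtain ⟨w, hw, -⟩ := hG.exists_path_of_dist u v
  let S : Fin 1 → V × V := fun _ => (u, v)
  let l : MovingCut G := ⟨fun _ => 1, fun _ _ => le_rfl⟩
  have hS : Connectable G S :=
    ⟨fun _ => w, fun _ => hw, fun i j hij => absurd (Subsingleton.elim i j) hij⟩
  have hl : l.Witnesses S G.diam := by
    refine ⟨by simp [MovingCut.capacity, l], ?_⟩
    rw [MovingCut.le_pairsDist_iff]
    intro _ _ w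
    rw [← huv]
    exact (dist_le w).trans (l.length_le_walkLength w)
  exact (le_csSup (bddAbove_movingCutPairs hS) ⟨l, hl⟩).trans
    (le_csSup (bddAbove_movingCutNumber G) ⟨1, S, hS, rfl⟩)

theorem movingCutNumber_le [Fintype V] (hG : G.Connected) :
    movingCutNumber G ≤ 80 * (gadgetNumber G + G.diam) := by
  refine csSup_le' ?_
  rintro m ⟨k, S, hS, rfl⟩
  refine csSup_le' ?_
  rintro β ⟨l, hl⟩
  rcases Nat.eq_zero_or_pos β with rfl | hβ
  · exact Nat.zero_le _
  -- a positive distance separates a source from its sink, so the graph is not a single vertex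
  have hD : 0 < G.diam := by
    have := hG.nonempty
    have i : Fin k := ⟨0, (Nat.zero_le _).trans_lt hl.1⟩
    have hne : (S i).1 ≠ (S i).2 := fun h => by
      have := (MovingCut.le_pairsDist_iff l).1 hl.2 i i (Walk.nil.copy rfl h)
      simp [MovingCut.walkLength] at this
      omega
    exact (hG.pos_dist_of_ne hne).trans_le (dist_le_diam (connected_iff_ediam_ne_top.1 hG))
  by_cases hbig : 4 * (9 * G.diam + 8) + 10 ≤ β
  · have := le_csSup (bddAbove_gadgetNumber G) (exists_gadget hG hS hl hbig)
    rw [← gadgetNumber] at this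
    omega
  · omega

end UniversalOptimality

theorem mainTheorem5 :
    ∃ (C : ℝ) (c : ℕ), 0 < C ∧
      ∀ (V : Type*) [Fintype V] (G : SimpleGraph V), G.Connected →
        ((UniversalOptimality.gadgetNumber G + G.diam : ℕ) : ℝ) ≤
            C * Real.log (Fintype.card V) ^ c * (UniversalOptimality.movingCutNumber G : ℝ) ∧
          (UniversalOptimality.movingCutNumber G : ℝ) ≤
            C * Real.log (Fintype.card V) ^ c *
              ((UniversalOptimality.gadgetNumber G + G.diam : ℕ) : ℝ) := by
  refine ⟨80, 0, by norm_num, fun V _ G hG => ?_⟩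
  have h1 := UniversalOptimality.gadgetNumber_le_movingCutNumber G
  have h2 := UniversalOptimality.diam_le_movingCutNumber hG
  have h3 := UniversalOptimality.movingCutNumber_le hG
  rw [pow_zero, mul_one]
  constructor
  · exact_mod_cast (by omega : UniversalOptimality.gadgetNumber G + G.diam ≤
      80 * UniversalOptimality.movingCutNumber G)
  · exact_mod_cast h3
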